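/- Let $d\ge 1$ and let $f:\mathbb R\to\mathbb R$ satisfy $|f(u_1)-f(u_2)|\le L(R)|u_1-u_2|$ whenever $|u_1|,|u_2|\le R$, for some increasing $L:[0,\infty)\to[0,\infty)$. Let $h:[0,\infty)\to(0,\infty)$ be twice differentiable, increasing and strictly convex, with $\int_0^\infty \frac{dx}{h(x)}=+\infty$, $h(x)\le C(1+x^p)$ for some $C>0$, $p>1$, and $|f(x)|\le h(|x|)$ for all $x\in\mathbb R$. Put $H(x)=\int_0^x\frac{dy}{h(y)}$ and assume that for every $t>0$ there are $\nu_t\in(0,2)$ and $C_t>0$ such that $H^{-1}(H(x)+t)\le C_t\exp(\exp(x^{\nu_t}))$ for all $x>0$. For $\alpha>1$ put $h_\alpha(x)=h(x^\alpha)/x^{\alpha-1}$ and $H_\alpha(x)=\int_0^x\frac{dy}{h_\alpha(y)}$, and assume that $h_\alpha$ is convex on $[1,\infty)$ for every $\alpha>1$. Let $T>0$ and $\alpha\in(1,2/\nu_{2T})$, let $B$ be a standard $d$-dimensional Wiener process, and for $t\in[0,T]$, $x\in\mathbb R^d$ define $$\rho_0(x)=\sqrt{\log(e+|x|^2)},\qquad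 \rho(t,x)=\mathbb E\left[H_\alpha^{-1}\big(H_\alpha(\rho_0(x+B(t)))+t\big)\right]\in[0,\infty].$$ If $\alpha\le 2$, then $\rho(t,x)<\infty$ for all $t\in[0,T]$, $x\in\mathbb R^d$. Moreover, for every $M$ there is a constant $K=K(T,M)>0$ (with $d,f,h,\alpha$ fixed) with the following property. Let $z:[0,T]\times\mathbb R^d\to\mathbb R$ be continuous with $\sup_{t\in[0,T]}\sup_{x\in\mathbb R^d}\frac{|z(t,x)|}{\rho_0(x)}=M$. For $N>0$ let $\tau_N(r)=\max(-N,\min(r,N))$, $z_N=\tau_N\circ z$ and $f_N=f\circ\tau_N$, and let $u_N:[0,T]\times\mathbb R^d\to\mathbb R$ be a bounded measurable solution of $$u_N(t,x)=\int_0^t\int_{\mathbb R^d}G(t-s,x-y)\,f_N(u_N(s,y))\,dy\,ds+z_N(t,x),\qquad G(t,x)=(2\pi t)^{-d/2}e^{-|x|^2/(2t)},$$ for all $t\in[0,T]$, $x\in\mathbb R^d$. Then $$\sup_{t\in[0,T]}\sup_{x\in\mathbb R^d}\frac{|u_N(t,x)|}{\rho(t,x)}\le K(T,M)$$ (where a quotient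 with denominator $+\infty$ is $0$); in particular $K$ does not depend on $N$ or on $z$ beyond $M$. -/

import Mathlib

open MeasureTheory ProbabilityTheory Set
open scoped ENNReal NNReal

noncomputable section

namespace OsgoodHeat

/-- `ℝᵈ` with the Euclidean norm. -/
abbrev Space (d : ℕ) : Type := EuclideanSpace ℝ (Fin d)

/-- The Osgood primitive `H(x) = ∫₀ˣ dy / h(y)`. -/
def osgoodPrimitive (h : ℝ → ℝ) (x : ℝ) : ℝ := ∫ y in (0 : ℝ)..x, 1 / h y

/-- The inverse `H⁻¹` of the Osgood primitive `H : [0,∞) → [0,∞)`. -/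
def osgoodInverse (h : ℝ → ℝ) : ℝ → ℝ := Function.invFunOn (osgoodPrimitive h) (Ici 0)

/-- The modified growth function `h_α(x) = h(x^α) / x^(α-1)`. -/
def hAlpha (h : ℝ → ℝ) (α x : ℝ) : ℝ := h (x ^ α) / x ^ (α - 1)

/-- Standing assumption on the drift `f`, the dominating function `h` (of which only the values on
`[0,∞)` matter) and the growth exponents `ν_t`. -/
structure DriftAssumption (f h ν : ℝ → ℝ) : Prop where
  /-- `f` is locally Lipschitz. -/
  locally_lipschitz : ∃ L : ℝ → ℝ, MonotoneOn L (Ici 0) ∧ (∀ R, 0 ≤ R → 0 ≤ L R) ∧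
    ∀ R u₁ u₂, |u₁| ≤ R → |u₂| ≤ R → |f u₁ - f u₂| ≤ L R * |u₁ - u₂|
  pos : ∀ x, 0 ≤ x → 0 < h x
  differentiable : DifferentiableOn ℝ h (Ici 0)
  twice_differentiable : DifferentiableOn ℝ (derivWithin h (Ici 0)) (Ici 0)
  increasing : MonotoneOn h (Ici 0)
  strictly_convex : StrictConvexOn ℝ (Ici 0) h
  /-- The Osgood condition `∫₀^∞ dx / h(x) = +∞`. -/
  osgood : ∫⁻ x in Ioi (0 : ℝ), ENNReal.ofReal (1 / h x) = ∞
  polynomial_growth : ∃ C p : ℝ, 0 < C ∧ 1 < p ∧ ∀ x, 0 ≤ x → h x ≤ C * (1 + x ^ p)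
  dominates : ∀ x, |f x| ≤ h |x|
  exponent_mem : ∀ t, 0 < t → ν t ∈ Ioo (0 : ℝ) 2
  /-- The growth restriction `H⁻¹(H(x) + t) ≤ C_t exp(exp(x^{ν_t}))`. -/
  growth : ∀ t, 0 < t → ∃ C : ℝ, 0 < C ∧ ∀ x, 0 < x →
    osgoodInverse h (osgoodPrimitive h x + t) ≤ C * Real.exp (Real.exp (x ^ ν t))
  hAlpha_convex : ∀ α, 1 < α → ConvexOn ℝ (Ici 1) (hAlpha h α)

/-- The static weight `ρ₀(x) = √(log(e + |x|²))`. -/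
def rho0 {d : ℕ} (x : Space d) : ℝ := Real.sqrt (Real.log (Real.exp 1 + ‖x‖ ^ 2))

/-- `B` is a standard `d`-dimensional Wiener process: its coordinates are independent standard
real Brownian motions. -/
structure IsStandardWiener {d : ℕ} {Ω : Type*} [MeasurableSpace Ω] (B : ℝ≥0 → Ω → Space d)
    (P : Measure Ω) : Prop where
  coordinate : ∀ i : Fin d, IsBrownianReal (fun t ω => B t ω i) P
  independent : iIndepFun (fun (i : Fin d) (ω : Ω) (t : ℝ≥0) => B t ω i) P

/-- The dynamic weight `ρ(t,x) = E[H_α⁻¹(H_α(ρ₀(x + B(t))) + t)]`, for `t ≥ 0`.  The expectation of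
this nonnegative random variable is taken in `[0,∞]`. -/
def dynamicWeight {d : ℕ} {Ω : Type*} [MeasurableSpace Ω] (h : ℝ → ℝ) (α : ℝ)
    (B : ℝ≥0 → Ω → Space d) (P : Measure Ω) (t : ℝ) (x : Space d) : ℝ≥0∞ :=
  ∫⁻ ω, ENNReal.ofReal (osgoodInverse (hAlpha h α)
    (osgoodPrimitive (hAlpha h α) (rho0 (x + B t.toNNReal ω)) + t)) ∂P

/-- The Gaussian heat kernel `G(t,x) = (2πt)^(-d/2) exp(-|x|²/(2t))`. -/
def heatKernel {d : ℕ} (t : ℝ) (x : Space d) : ℝ :=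
  (2 * Real.pi * t) ^ (-(d : ℝ) / 2) * Real.exp (-‖x‖ ^ 2 / (2 * t))

/-- The cutoff at level `N > 0`: `r` if `|r| ≤ N`, `N` if `r > N`, and `-N` if `r < -N`. -/
def cutoff (N r : ℝ) : ℝ := max (-N) (min r N)

/-- `u` is a bounded (measurable) solution on `[0,T] × ℝᵈ` of the truncated integral equation
`u(t,x) = ∫₀ᵗ ∫ G(t-s,x-y) f_N(u(s,y)) dy ds + z_N(t,x)`, where `f_N(r) = f(cutoff N r)` and
`z_N(t,x) = cutoff N (z(t,x))`. -/
structure IsTruncatedSolution {d : ℕ} (f : ℝ → ℝ) (z : ℝ → Space d → ℝ) (T N : ℝ)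
    (u : ℝ → Space d → ℝ) : Prop where
  measurable : Measurable (fun p : Icc (0 : ℝ) T × Space d => u p.1 p.2)
  bounded : ∃ C : ℝ, ∀ t ∈ Icc 0 T, ∀ x, |u t x| ≤ C
  equation : ∀ t ∈ Icc 0 T, ∀ x,
    u t x = (∫ s in (0 : ℝ)..t, ∫ y, heatKernel (t - s) (x - y) * f (cutoff N (u s y)))
      + cutoff N (z t x)

end OsgoodHeat

end

noncomputable section

namespace OsgoodHeat

/-! Let `E` denote `H⁻¹`, so that `s ↦ E (H a + s)` solves `ψ' = h(ψ)`, `ψ(0) = a`, and let `P_t` be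
the heat semigroup. The barrier is `w(t) = P_t ψ_t`, where `ψ_t = E (H (m ρ₀) + t)` is the flow
started pointwise from `m ρ₀`. Integrating the flow equation in time gives `w(t) = P_t(m ρ₀) + ∫₀ᵗ
P_(t-s) P_s h(ψ_s) ds`, and Jensen's inequality gives `P_s h(ψ_s) ≥ h(P_s ψ_s) = h(w(s))`. Since
`P_t ρ₀ ≥ ρ₀ / 2`, the choice `m = 2 max(M, 1)` makes the first term dominate `|z|`, so `w` is a
supersolution of the equation satisfied by `|u_N|` as a subsolution (`flowWeight_isSupersolution`).

Truncation makes the source Lipschitz, with a constant depending on `N`. An iterated Gronwall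
argument (`comparison`) then yields `|u_N| ≤ w`, and the Lipschitz constant disappears in the limit.
It remains to bound `w` by `K ρ`, pointwise under the expectation. The substitution `y ↦ y^α`
identifies the `h_α`-flow from `r` with `E (H (r^α) + α t)^(1/α)`, and convexity of `h` compares
this with `E (H (m r) + t)` through logarithmic derivatives (`log_flow_le`, `exists_flow_le`).

All integrals are taken in `[0,∞]`, so the bound needs no finiteness of `w` or `ρ`. Finiteness for
`α ≤ 2` is separate: since `α ν < 2`, the double exponential in the growth condition is at most `exp
(A (2 + ‖y‖))`, which is Gaussian integrable. -/

/-! ### Gaussian laws and the heat kernel -/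

/-- The centred Gaussian law on `ℝᵈ` with covariance `t • 1`, characterised by its Fourier
transform. -/
structure IsHeatLaw {d : ℕ} (t : ℝ) (μ : Measure (Space d)) : Prop where
  isProbabilityMeasure : IsProbabilityMeasure μ
  charFun_eq : ∀ w, charFun μ w = Complex.exp ((-(t * ‖w‖ ^ 2 / 2) : ℝ))

lemma IsHeatLaw.unique {d : ℕ} {t : ℝ} {μ κ : Measure (Space d)} (hμ : IsHeatLaw t μ)
    (hκ : IsHeatLaw t κ) : μ = κ := by
  have := hμ.isProbabilityMeasure
  have := hκ.isProbabilityMeasure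
  refine Measure.ext_of_charFun (funext fun w => ?_)
  rw [hμ.charFun_eq, hκ.charFun_eq]

lemma IsHeatLaw.conv {d : ℕ} {s t : ℝ} {μ κ : Measure (Space d)} (hμ : IsHeatLaw s μ)
    (hκ : IsHeatLaw t κ) : IsHeatLaw (s + t) (μ ∗ κ) := by
  have := hμ.isProbabilityMeasure
  have := hκ.isProbabilityMeasure
  refine ⟨inferInstance, fun w => ?_⟩
  rw [charFun_conv, hμ.charFun_eq, hκ.charFun_eq, ← Complex.exp_add, ← Complex.ofReal_add]
  congr 2
  ring

lemma IsHeatLaw.map_neg {d : ℕ} {t : ℝ} {μ : Measure (Space d)} (hμ : IsHeatLaw t μ) :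
    IsHeatLaw t (μ.map fun y => -y) := by
  have := hμ.isProbabilityMeasure
  refine ⟨Measure.isProbabilityMeasure_map (by fun_prop), fun w => ?_⟩
  have h1 := charFun_map_smul (μ := μ) (-1) w
  simp only [neg_smul, one_smul] at h1
  rw [h1, hμ.charFun_eq, norm_neg]

lemma IsHeatLaw.lintegral_comp_neg {d : ℕ} {t : ℝ} {μ : Measure (Space d)} (hμ : IsHeatLaw t μ)
    {F : Space d → ℝ≥0∞} (hF : Measurable F) : ∫⁻ y, F (-y) ∂μ = ∫⁻ y, F y ∂μ := by
  conv_rhs => rw [hμ.unique hμ.map_neg, lintegral_map hF (by fun_prop)]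

lemma continuous_heatKernel {d : ℕ} (t : ℝ) : Continuous (heatKernel (d := d) t) := by
  unfold heatKernel
  fun_prop

lemma heatKernel_nonneg {d : ℕ} {t : ℝ} (ht : 0 ≤ t) (x : Space d) : 0 ≤ heatKernel t x := by
  unfold heatKernel
  positivity

lemma integrable_heatKernel_mul_cexp {d : ℕ} {t : ℝ} (ht : 0 < t) (w : Space d) :
    Integrable (fun v : Space d => (heatKernel t v : ℂ) * Complex.exp (inner ℝ v w * Complex.I)) ∧
    ∫ v : Space d, (heatKernel t v : ℂ) * Complex.exp (inner ℝ v w * Complex.I) =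
      Complex.exp ((-(t * ‖w‖ ^ 2 / 2) : ℝ)) := by
  have hb : 0 < ((1 / (2 * t) : ℝ) : ℂ).re := by
    rw [Complex.ofReal_re]; positivity
  have key : (fun v : Space d => (heatKernel t v : ℂ) * Complex.exp (inner ℝ v w * Complex.I)) =
      fun v => (((2 * Real.pi * t) ^ (-(d : ℝ) / 2) : ℝ) : ℂ) *
        Complex.exp (-((1 / (2 * t) : ℝ) : ℂ) * (‖v‖ : ℂ) ^ 2 + Complex.I * (inner ℝ w v : ℝ)) := by
    funext v
    simp only [heatKernel]
    rw [Complex.ofReal_mul, mul_assoc, Complex.ofReal_exp, ← Complex.exp_add, real_inner_comm]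
    congr 2
    push_cast
    ring
  rw [key]
  refine ⟨(GaussianFourier.integrable_cexp_neg_mul_sq_norm_add hb Complex.I w).const_mul _, ?_⟩
  rw [integral_const_mul, GaussianFourier.integral_cexp_neg_mul_sq_norm_add hb Complex.I w,
    ← mul_assoc]
  have h1 : ((Real.pi : ℂ) / ((1 / (2 * t) : ℝ) : ℂ)) ^ ((Module.finrank ℝ (Space d) : ℂ) / 2) =
      (((2 * Real.pi * t) ^ ((d : ℝ) / 2) : ℝ) : ℂ) := by
    rw [← Complex.ofReal_div, Complex.ofReal_cpow (by positivity), finrank_euclideanSpace_fin]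
    have h2 : Real.pi / (1 / (2 * t)) = 2 * Real.pi * t := by field_simp
    rw [h2]
    push_cast
    rfl
  rw [h1, ← Complex.ofReal_mul, ← Real.rpow_add (by positivity)]
  have h3 : -(d : ℝ) / 2 + (d : ℝ) / 2 = 0 := by ring
  rw [h3, Real.rpow_zero, Complex.ofReal_one, one_mul, Complex.I_sq]
  congr 1
  have ht' : (t : ℂ) ≠ 0 := by exact_mod_cast ht.ne'
  push_cast
  field_simp
  ring

lemma isHeatLaw_withDensity {d : ℕ} {t : ℝ} (ht : 0 < t) :
    IsHeatLaw t ((volume : Measure (Space d)).withDensity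
      fun y => ENNReal.ofReal (heatKernel t y)) := by
  have hmeas : Measurable fun y : Space d => ENNReal.ofReal (heatKernel t y) :=
    (continuous_heatKernel t).measurable.ennreal_ofReal
  refine ⟨⟨?_⟩, fun w => ?_⟩
  · rw [withDensity_apply _ MeasurableSet.univ, Measure.restrict_univ]
    obtain ⟨h1, h2⟩ := integrable_heatKernel_mul_cexp (d := d) ht 0
    simp only [inner_zero_right, Complex.ofReal_zero, zero_mul, Complex.exp_zero, mul_one,
      norm_zero] at h1 h2
    have h3 : Integrable (heatKernel (d := d) t) := by simpa using h1.re
    rw [integral_complex_ofReal] at h2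
    rw [← ofReal_integral_eq_lintegral_ofReal h3
      (Filter.Eventually.of_forall fun y => heatKernel_nonneg ht.le y)]
    have h4 : ∫ y : Space d, heatKernel t y = 1 := by
      have : ((∫ y : Space d, heatKernel t y : ℝ) : ℂ) = 1 := by simpa using h2
      exact_mod_cast this
    rw [h4, ENNReal.ofReal_one]
  · rw [charFun_apply, integral_withDensity_eq_integral_toReal_smul hmeas
      (Filter.Eventually.of_forall fun y => ENNReal.ofReal_lt_top),
      ← (integrable_heatKernel_mul_cexp ht w).2]
    refine integral_congr_ae (Filter.Eventually.of_forall fun y => ?_)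
    simp only [ENNReal.toReal_ofReal (heatKernel_nonneg ht.le y)]
    rfl

lemma IsHeatLaw.lintegral_eq {d : ℕ} {t : ℝ} (ht : 0 < t) {μ : Measure (Space d)}
    (hμ : IsHeatLaw t μ) {F : Space d → ℝ≥0∞} (hF : Measurable F) (x : Space d) :
    ∫⁻ y, F (x + y) ∂μ = ∫⁻ y, ENNReal.ofReal (heatKernel t (x - y)) * F y := by
  have h0 : Measurable fun y : Space d => F (x - y) := by fun_prop
  have h1 := hμ.lintegral_comp_neg h0
  simp only [sub_neg_eq_add] at h1
  rw [h1, hμ.unique (isHeatLaw_withDensity ht),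
    lintegral_withDensity_eq_lintegral_mul _ (continuous_heatKernel t).measurable.ennreal_ofReal h0]
  rw [← lintegral_sub_left_eq_self _ x]
  simp

lemma IsHeatLaw.lintegral_exp_norm_lt_top {d : ℕ} {t : ℝ} (ht : 0 ≤ t) {μ : Measure (Space d)}
    (hμ : IsHeatLaw t μ) (c : ℝ) : ∫⁻ y, ENNReal.ofReal (Real.exp (c * ‖y‖)) ∂μ < ∞ := by
  have := hμ.isProbabilityMeasure
  have hinner : ∀ x y : Space d, (innerSL ℝ x) y = inner ℝ x y := fun _ _ => rfl
  have hG : IsGaussian μ := by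
    rw [isGaussian_iff_gaussian_charFun]
    refine ⟨0, t • innerSL ℝ, ⟨⟨fun x y => ?_⟩, ⟨fun x => ?_⟩⟩, fun w => ?_⟩
    · simp [hinner, real_inner_comm]
    · simpa [hinner] using mul_nonneg ht (sq_nonneg ‖x‖)
    · simp [hμ.charFun_eq, hinner]
  -- Fernique's theorem; completing the square absorbs `c ‖y‖` into `a ‖y‖ ^ 2` at the cost of `c ^
  -- 2 / (4 * a)`.
  obtain ⟨a, ha, hint⟩ := IsGaussian.exists_integrable_exp_sq μ
  have hint' := hint.const_mul (Real.exp (c ^ 2 / (4 * a)))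
  refine lt_of_le_of_lt (lintegral_mono fun y => ENNReal.ofReal_le_ofReal ?_)
    hint'.lintegral_lt_top
  rw [← Real.exp_add, Real.exp_le_exp]
  have : c ^ 2 / (4 * a) + a * ‖y‖ ^ 2 - c * ‖y‖ = (c - 2 * a * ‖y‖) ^ 2 / (4 * a) := by
    field_simp; ring
  have h2 : 0 ≤ (c - 2 * a * ‖y‖) ^ 2 / (4 * a) := by positivity
  linarith

lemma IsStandardWiener.aemeasurable {d : ℕ} {Ω : Type*} [MeasurableSpace Ω] {P : Measure Ω}
    {B : ℝ≥0 → Ω → Space d} (hB : IsStandardWiener B P) (t : ℝ≥0) : AEMeasurable (B t) P := by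
  have h1 : AEMeasurable (fun ω i => B t ω i) P :=
    aemeasurable_pi_lambda _ fun i => (hB.coordinate i).toIsPreBrownianReal.aemeasurable t
  exact (WithLp.measurable_toLp 2 (Fin d → ℝ)).comp_aemeasurable h1

lemma IsStandardWiener.isHeatLaw {d : ℕ} {Ω : Type*} [MeasurableSpace Ω] {P : Measure Ω}
    [IsProbabilityMeasure P] {B : ℝ≥0 → Ω → Space d} (hB : IsStandardWiener B P) {t : ℝ}
    (ht : 0 ≤ t) : IsHeatLaw t (P.map (B t.toNNReal)) := by
  refine ⟨Measure.isProbabilityMeasure_map (hB.aemeasurable _), fun w => ?_⟩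
  have hm : ∀ i, AEMeasurable (fun ω => B t.toNNReal ω i) P :=
    fun i => (hB.coordinate i).toIsPreBrownianReal.aemeasurable _
  have hind : iIndepFun (fun (i : Fin d) ω => B t.toNNReal ω i) P :=
    hB.independent.comp (fun _ b => b t.toNNReal) fun _ => measurable_pi_apply _
  have h := (iIndepFun_iff_charFun_pi hm).1 hind w
  have h' : (fun ω => WithLp.toLp 2 fun i => B t.toNNReal ω i) = B t.toNNReal := rfl
  rw [h'] at h
  rw [h]
  have hi : ∀ i, P.map (fun ω => B t.toNNReal ω i) = gaussianReal 0 t.toNNReal :=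
    fun i => ((hB.coordinate i).toIsPreBrownianReal.hasLaw_eval _).map_eq
  simp_rw [hi, charFun_gaussianReal, ← Complex.exp_sum, EuclideanSpace.real_norm_sq_eq]
  congr 1
  simp [Finset.mul_sum, Finset.sum_div, Real.coe_toNNReal _ ht]

/-! ### The Osgood flow and its conjugate under a power map -/

/-- `H : ℝ → ℝ` extends the Osgood primitive of `h` to an increasing bijection of the line with
inverse `E`, the flow of the equation `E' = h(E)`. -/
structure IsOsgoodFlow (h H E : ℝ → ℝ) : Prop where
  strictMono : StrictMono H
  map_zero : H 0 = 0
  left_inv : ∀ x, E (H x) = x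
  right_inv : ∀ s, H (E s) = s
  hasDerivAt_primitive : ∀ x, 0 ≤ x → HasDerivAt H (1 / h x) x
  continuous_primitive : Continuous H
  hasDerivAt_inverse : ∀ s, HasDerivAt E (h (max (E s) 0)) s
  primitive_eq : ∀ x, 0 ≤ x → osgoodPrimitive h x = H x
  inverse_eq : ∀ s, 0 ≤ s → osgoodInverse h s = E s

lemma exists_isOsgoodFlow {h : ℝ → ℝ} (hpos : ∀ x, 0 ≤ x → 0 < h x)
    (hcont : ContinuousOn h (Ici 0))
    (hosg : ∫⁻ x in Ioi (0 : ℝ), ENNReal.ofReal (1 / h x) = ∞) :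
    ∃ H E, IsOsgoodFlow h H E := by
  -- Freezing `h` at `h 0` on the negative axis makes `H` linear there, hence unbounded below; the
  -- Osgood condition makes it unbounded above.
  set g : ℝ → ℝ := fun x => 1 / h (max x 0) with hg
  have hgpos : ∀ x, 0 < g x := fun x => one_div_pos.2 (hpos _ (le_max_right _ _))
  have hgcont : Continuous g := by
    refine continuous_const.div ?_ fun x => (hpos _ (le_max_right _ _)).ne'
    exact hcont.comp_continuous (by fun_prop) fun x => mem_Ici.2 (le_max_right _ _)
  set H : ℝ → ℝ := fun x => ∫ y in (0 : ℝ)..x, g y with hH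
  have hderiv : ∀ x, HasDerivAt H (g x) x :=
    fun x => (hgcont.integral_hasStrictDerivAt 0 x).hasDerivAt
  have hHcont : Continuous H := continuous_iff_continuousAt.2 fun x => (hderiv x).continuousAt
  have hmono : StrictMono H := strictMono_of_deriv_pos fun x => by
    rw [(hderiv x).deriv]; exact hgpos x
  have hH0 : H 0 = 0 := by simp [hH]
  have hunb : ∀ s, ∃ x, s ≤ H x := by
    intro s
    by_contra! hcon
    have hint : IntegrableOn g (Ioi 0) := by
      refine integrableOn_Ioi_of_intervalIntegral_norm_bounded s 0
        (fun n : ℕ => hgcont.integrableOn_Ioc) tendsto_natCast_atTop_atTop ?_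
      refine Filter.Eventually.of_forall fun n => ?_
      have : (fun x => ‖g x‖) = g := funext fun x => Real.norm_of_nonneg (hgpos x).le
      rw [this]
      exact (hcon n).le
    refine absurd hosg (ne_of_lt ?_)
    refine lt_of_eq_of_lt (setLIntegral_congr_fun measurableSet_Ioi fun x hx => ?_)
      hint.lintegral_lt_top
    simp only [hg, max_eq_left (le_of_lt (mem_Ioi.1 hx))]
  have hneg : ∀ x, x ≤ 0 → H x = x / h 0 := by
    intro x hx
    have : H x = ∫ y in (0 : ℝ)..x, 1 / h 0 := by
      refine intervalIntegral.integral_congr fun y hy => ?_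
      rw [uIcc_of_ge hx] at hy
      simp only [hg, max_eq_right hy.2]
    rw [this, intervalIntegral.integral_const, smul_eq_mul]
    ring
  have hsurj : Function.Surjective H := by
    intro s
    obtain ⟨b, hb⟩ := hunb s
    have hha : H (min (s * h 0) 0) ≤ s := by
      rw [hneg _ (min_le_right _ _), div_le_iff₀ (hpos 0 le_rfl)]
      exact min_le_left _ _
    obtain ⟨x, -, hx⟩ := intermediate_value_uIcc (a := min (s * h 0) 0) (b := b)
      hHcont.continuousOn (mem_uIcc_of_le hha hb)
    exact ⟨x, hx⟩
  set e := hmono.orderIsoOfSurjective H hsurj with he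
  have hl : ∀ x, e.symm (H x) = x := fun x => e.symm_apply_apply x
  have hr : ∀ s, H (e.symm s) = s := fun s => e.apply_symm_apply s
  have hprim : ∀ x, 0 ≤ x → osgoodPrimitive h x = H x := by
    intro x hx
    refine intervalIntegral.integral_congr fun y hy => ?_
    rw [uIcc_of_le hx] at hy
    simp only [hg, max_eq_left hy.1]
  refine ⟨H, e.symm, hmono, hH0, hl, hr, fun x hx => ?_, hHcont, fun s => ?_, hprim,
    fun s hs => ?_⟩
  · have := hderiv x
    simp only [hg, max_eq_left hx] at this
    exact this
  · have := HasDerivAt.of_local_left_inverse (e.symm.continuous.continuousAt (x := s))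
      (hderiv (e.symm s)) (hgpos _).ne' (Filter.Eventually.of_forall hr)
    simpa [hg] using this
  · have h0 : 0 ≤ e.symm s := by
      rw [← hmono.le_iff_le, hr, hH0]; exact hs
    have hex : ∃ y ∈ Ici (0 : ℝ), osgoodPrimitive h y = s := ⟨_, h0, by rw [hprim _ h0, hr]⟩
    have h1 := Function.invFunOn_mem hex
    have h2 := Function.invFunOn_eq hex
    rw [hprim _ h1] at h2
    rw [osgoodInverse, ← hmono.injective.eq_iff, h2, hr]

namespace IsOsgoodFlow

variable {h H E : ℝ → ℝ}

lemma monotone_inverse (hE : IsOsgoodFlow h H E) : StrictMono E := fun s t hst => by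
  rw [← hE.strictMono.lt_iff_lt, hE.right_inv, hE.right_inv]; exact hst

lemma continuous_inverse (hE : IsOsgoodFlow h H E) : Continuous E :=
  continuous_iff_continuousAt.2 fun s => (hE.hasDerivAt_inverse s).continuousAt

lemma primitive_nonneg (hE : IsOsgoodFlow h H E) {x : ℝ} (hx : 0 ≤ x) : 0 ≤ H x := by
  rw [← hE.map_zero]; exact hE.strictMono.monotone hx

lemma le_inverse_add (hE : IsOsgoodFlow h H E) (x : ℝ) {t : ℝ} (ht : 0 ≤ t) :
    x ≤ E (H x + t) := by
  conv_lhs => rw [← hE.left_inv x]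
  exact hE.monotone_inverse.monotone (by linarith)

/-- The factor `x ^ (α - 1)` in `hAlpha` is, up to `α`, the Jacobian of `x ↦ x ^ α`, so `H_α` is a
change of variables in `H`. -/
lemma primitive_hAlpha (hE : IsOsgoodFlow h H E) (hpos : ∀ x, 0 ≤ x → 0 < h x)
    (hcont : ContinuousOn h (Ici 0)) {α : ℝ} (hα : 1 < α) {x : ℝ} (hx : 0 ≤ x) :
    osgoodPrimitive (hAlpha h α) x = H (x ^ α) / α := by
  have hd : ∀ y ∈ uIcc 0 x, HasDerivAt (fun y => H (y ^ α) / α) (1 / hAlpha h α y) y := by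
    intro y hy
    rw [uIcc_of_le hx] at hy
    have h1 := (hE.hasDerivAt_primitive _ (Real.rpow_nonneg hy.1 α)).comp y
      (Real.hasDerivAt_rpow_const (x := y) (p := α) (Or.inr hα.le))
    convert! h1.div_const α using 1
    rw [hAlpha]
    have := (hpos _ (Real.rpow_nonneg hy.1 α)).ne'
    have hα0 : α ≠ 0 := by positivity
    rw [one_div_div]
    field_simp
  have hc : ContinuousOn (fun y => 1 / hAlpha h α y) (uIcc 0 x) := by
    rw [uIcc_of_le hx]
    have : (fun y => 1 / hAlpha h α y) = fun y => y ^ (α - 1) / h (y ^ α) := by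
      funext y; rw [hAlpha, one_div_div]
    rw [this]
    refine ContinuousOn.div ?_ ?_ fun y hy => (hpos _ (Real.rpow_nonneg hy.1 α)).ne'
    · exact (Real.continuous_rpow_const (by linarith)).continuousOn
    · exact hcont.comp (Real.continuous_rpow_const (by linarith)).continuousOn
        fun y hy => Real.rpow_nonneg hy.1 α
  rw [osgoodPrimitive, intervalIntegral.integral_eq_sub_of_hasDerivAt hd hc.intervalIntegrable,
    Real.zero_rpow (by linarith), hE.map_zero]
  ring

lemma inverse_hAlpha (hE : IsOsgoodFlow h H E) (hpos : ∀ x, 0 ≤ x → 0 < h x)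
    (hcont : ContinuousOn h (Ici 0)) {α : ℝ} (hα : 1 < α) {s : ℝ} (hs : 0 ≤ s) :
    osgoodInverse (hAlpha h α) s = E (α * s) ^ (1 / α) := by
  have hα0 : 0 < α := by linarith
  have hE0 : 0 ≤ E (α * s) := by
    rw [← hE.strictMono.le_iff_le, hE.right_inv, hE.map_zero]
    positivity
  have hcancel : α * s / α = s := by field_simp
  have hex : ∃ y ∈ Ici (0 : ℝ), osgoodPrimitive (hAlpha h α) y = s := by
    refine ⟨E (α * s) ^ (1 / α), Real.rpow_nonneg hE0 _, ?_⟩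
    rw [hE.primitive_hAlpha hpos hcont hα (Real.rpow_nonneg hE0 _), one_div,
      Real.rpow_inv_rpow hE0 hα0.ne', hE.right_inv, hcancel]
  have h1 := Function.invFunOn_mem hex
  have h2 := Function.invFunOn_eq hex
  rw [hE.primitive_hAlpha hpos hcont hα h1] at h2
  have h3 : osgoodInverse (hAlpha h α) s ^ α = E (α * s) := by
    rw [← hE.strictMono.injective.eq_iff, hE.right_inv, osgoodInverse]
    field_simp at h2
    linarith
  have h1' : 0 ≤ osgoodInverse (hAlpha h α) s := h1
  rw [← h3, one_div, Real.rpow_rpow_inv h1' hα0.ne']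

lemma flow_hAlpha (hE : IsOsgoodFlow h H E) (hpos : ∀ x, 0 ≤ x → 0 < h x)
    (hcont : ContinuousOn h (Ici 0)) {α : ℝ} (hα : 1 < α) {r t : ℝ} (hr : 0 ≤ r) (ht : 0 ≤ t) :
    osgoodInverse (hAlpha h α) (osgoodPrimitive (hAlpha h α) r + t) =
      E (H (r ^ α) + α * t) ^ (1 / α) := by
  have hα0 : 0 < α := by linarith
  have h0 := hE.primitive_nonneg (Real.rpow_nonneg hr α)
  rw [hE.primitive_hAlpha hpos hcont hα hr,
    hE.inverse_hAlpha hpos hcont hα (by positivity)]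
  congr 2
  field_simp

end IsOsgoodFlow

/-! ### Comparison of the two flows -/

/-- Let `ψ` be the flow from `a` and `Q` the flow from `r ^ α` run at speed `α`; then `ψ ≤ Q`. The
logarithms of `ψ` and `Q ^ (1 / α)` have derivatives `h(ψ)/ψ` and `h(Q)/Q`. By convexity `(h(x) -
h(0))/x` is nondecreasing, so the first exceeds the second by at most `h(0)/ψ ≤ h(0)/a`. -/
lemma log_flow_le {h H E : ℝ → ℝ} (hE : IsOsgoodFlow h H E) (hpos : ∀ x, 0 ≤ x → 0 < h x)
    (hconv : ConvexOn ℝ (Ici 0) h) {α : ℝ} (hα : 1 < α) {a r t : ℝ} (ha : 0 < a) (hr : 0 < r)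
    (har : a ≤ r ^ α) (ht : 0 ≤ t) :
    Real.log (E (H a + t)) ≤
      Real.log a + Real.log (E (H (r ^ α) + α * t) ^ (1 / α)) - Real.log r + h 0 / a * t := by
  have hα0 : 0 < α := by linarith
  have hb : 0 < r ^ α := Real.rpow_pos_of_pos hr α
  have hψ : ∀ s, 0 ≤ s → a ≤ E (H a + s) := fun s hs => hE.le_inverse_add a hs
  have hQ : ∀ s, 0 ≤ s → r ^ α ≤ E (H (r ^ α) + α * s) :=
    fun s hs => hE.le_inverse_add _ (by positivity)
  have hψQ : ∀ s, 0 ≤ s → E (H a + s) ≤ E (H (r ^ α) + α * s) := fun s hs =>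
    hE.monotone_inverse.monotone (add_le_add (hE.strictMono.monotone har) (by nlinarith))
  set D : ℝ → ℝ := fun s =>
    Real.log (E (H a + s)) - (1 / α) * Real.log (E (H (r ^ α) + α * s)) - h 0 / a * s with hD
  have hderiv : ∀ s, 0 ≤ s → HasDerivAt D (h (E (H a + s)) / E (H a + s) -
      h (E (H (r ^ α) + α * s)) / E (H (r ^ α) + α * s) - h 0 / a) s := by
    intro s hs
    have p1 : 0 < E (H a + s) := ha.trans_le (hψ s hs)
    have p2 : 0 < E (H (r ^ α) + α * s) := hb.trans_le (hQ s hs)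
    have d1 := ((hE.hasDerivAt_inverse (H a + s)).comp s
      ((hasDerivAt_id s).const_add (H a))).log p1.ne'
    have d2 := (((hE.hasDerivAt_inverse (H (r ^ α) + α * s)).comp s
      (((hasDerivAt_id s).const_mul α).const_add (H (r ^ α)))).log p2.ne').const_mul (1 / α)
    have d3 := (hasDerivAt_id s).const_mul (h 0 / a)
    refine ((d1.sub d2).sub d3).congr_deriv ?_
    simp only [max_eq_left p1.le, max_eq_left p2.le, Function.comp_apply, id_eq]
    field_simp
  have hanti : AntitoneOn D (Ici 0) := by
    refine antitoneOn_of_deriv_nonpos (convex_Ici 0)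
      (fun s hs => (hderiv s hs).continuousAt.continuousWithinAt)
      (fun s hs => (hderiv s (interior_subset hs)).differentiableAt.differentiableWithinAt) ?_
    intro s hs
    have hs0 : 0 ≤ s := interior_subset hs
    rw [(hderiv s hs0).deriv]
    have p1 : 0 < E (H a + s) := ha.trans_le (hψ s hs0)
    have p2 : 0 < E (H (r ^ α) + α * s) := hb.trans_le (hQ s hs0)
    have hsec := hconv.secant_mono (a := 0) (mem_Ici.2 le_rfl) (mem_Ici.2 p1.le)
      (mem_Ici.2 p2.le) p1.ne' p2.ne' (hψQ s hs0)
    rw [sub_zero, sub_zero, sub_div, sub_div] at hsec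
    have h1 : h 0 / E (H a + s) ≤ h 0 / a :=
      div_le_div_of_nonneg_left (hpos 0 le_rfl).le ha (hψ s hs0)
    have h2 : 0 ≤ h 0 / E (H (r ^ α) + α * s) := div_nonneg (hpos 0 le_rfl).le p2.le
    linarith
  have hfin := hanti (mem_Ici.2 le_rfl) (mem_Ici.2 ht) ht
  simp only [hD, add_zero, mul_zero, hE.left_inv, sub_zero, Real.log_rpow hr] at hfin
  rw [Real.log_rpow (hb.trans_le (hQ t ht))]
  have : 1 / α * (α * Real.log r) = Real.log r := by field_simp
  linarith

lemma exists_flow_le {h H E : ℝ → ℝ} (hE : IsOsgoodFlow h H E) (hpos : ∀ x, 0 ≤ x → 0 < h x)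
    (hconv : ConvexOn ℝ (Ici 0) h) {α : ℝ} (hα : 1 < α) {m : ℝ} (hm : 0 < m) (T : ℝ) :
    ∃ K, 0 < K ∧ ∀ r, 1 ≤ r → ∀ t ∈ Icc 0 T,
      E (H (m * r) + t) ≤ K * E (H (r ^ α) + α * t) ^ (1 / α) := by
  -- `K₁` serves when `m * r ≤ r ^ α`. Otherwise `r` is at most `m ^ (1 / (α - 1))`, and `K₂` bounds
  -- the flow outright while the right-hand power is at least `1`.
  set K₁ := m * Real.exp (h 0 / m * T) with hK₁
  set K₂ := E (H (m * m ^ (1 / (α - 1))) + T) with hK₂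
  have hK₁0 : 0 < K₁ := by positivity
  refine ⟨max K₁ K₂, lt_max_of_lt_left hK₁0, fun r hr t ht => ?_⟩
  have hr0 : 0 < r := by linarith
  have hα0 : 0 < α := by linarith
  have hQ : 1 ≤ E (H (r ^ α) + α * t) :=
    (Real.one_le_rpow hr hα0.le).trans (hE.le_inverse_add _ (mul_nonneg hα0.le ht.1))
  have hφ : 1 ≤ E (H (r ^ α) + α * t) ^ (1 / α) := Real.one_le_rpow hQ (by positivity)
  have hφ0 := zero_lt_one.trans_le hφ
  rcases le_or_gt (m * r) (r ^ α) with hmr | hmr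
  · have hl := log_flow_le hE hpos hconv hα (mul_pos hm hr0) hr0 hmr ht.1
    have hψ0 : 0 < E (H (m * r) + t) := (mul_pos hm hr0).trans_le (hE.le_inverse_add _ ht.1)
    have h1 : h 0 / (m * r) * t ≤ h 0 / m * T := by
      have h0 := (hpos 0 le_rfl).le
      refine mul_le_mul (div_le_div_of_nonneg_left h0 hm (by nlinarith)) ht.2 ht.1 ?_
      positivity
    rw [Real.log_mul hm.ne' hr0.ne'] at hl
    refine le_trans ?_ (mul_le_mul_of_nonneg_right (le_max_left K₁ K₂) hφ0.le)
    rw [← Real.log_le_log_iff hψ0 (mul_pos hK₁0 hφ0), Real.log_mul hK₁0.ne' hφ0.ne', hK₁,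
      Real.log_mul hm.ne' (Real.exp_pos _).ne', Real.log_exp]
    linarith
  · have hr1 : r ≤ m ^ (1 / (α - 1)) := by
      have h1 : r ^ (α - 1) ≤ m := by
        rw [Real.rpow_sub hr0, Real.rpow_one, div_le_iff₀ hr0]
        exact hmr.le
      have h2 := Real.rpow_le_rpow (Real.rpow_nonneg hr0.le _) h1
        (one_div_nonneg.2 (sub_nonneg.2 hα.le))
      rwa [one_div, Real.rpow_rpow_inv hr0.le (by linarith), ← one_div] at h2
    have h3 : E (H (m * r) + t) ≤ K₂ := hE.monotone_inverse.monotone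
      (add_le_add (hE.strictMono.monotone (by gcongr)) ht.2)
    have hK₂0 : 0 ≤ max K₁ K₂ := hK₁0.le.trans (le_max_left _ _)
    calc E (H (m * r) + t) ≤ max K₁ K₂ := h3.trans (le_max_right _ _)
      _ = max K₁ K₂ * 1 := (mul_one _).symm
      _ ≤ _ := mul_le_mul_of_nonneg_left hφ hK₂0

/-! ### Convexity and the truncated source -/

lemma exists_supporting_slope {h : ℝ → ℝ} (hdiff : DifferentiableOn ℝ h (Ici 0))
    (hmono : MonotoneOn h (Ici 0)) (hconv : ConvexOn ℝ (Ici 0) h) {r : ℝ} (hr : 0 < r) :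
    ∃ k, 0 ≤ k ∧ ∀ x, 0 ≤ x → h r + k * x ≤ h x + k * r := by
  have hd : HasDerivAt h (deriv h r) r :=
    (hdiff.differentiableAt (Ici_mem_nhds hr)).hasDerivAt
  refine ⟨deriv h r, ?_, fun x hx => ?_⟩
  · refine le_trans ?_ (hconv.slope_le_of_hasDerivAt (mem_Ici.2 le_rfl) (mem_Ici.2 hr.le) hr hd)
    rw [slope_def_field]
    exact div_nonneg (sub_nonneg.2 (hmono (mem_Ici.2 le_rfl) (mem_Ici.2 hr.le) hr.le))
      (by linarith)
  · rcases lt_trichotomy x r with hxr | rfl | hxr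
    · have := hconv.slope_le_of_hasDerivAt (mem_Ici.2 hx) (mem_Ici.2 hr.le) hxr hd
      rw [slope_def_field, div_le_iff₀ (by linarith)] at this
      linarith
    · rfl
    · have := hconv.le_slope_of_hasDerivAt (mem_Ici.2 hr.le) (mem_Ici.2 hx) hxr hd
      rw [slope_def_field, le_div_iff₀ (by linarith)] at this
      linarith

/-- Slopes of a convex function increase, so the slope on `[b, a]` is at most that on `[a, N + 1]`.
The latter interval has length at least `1` and `h` is positive, whence the bound `h (N + 1)`. -/
lemma le_add_mul_sub_of_convexOn {h : ℝ → ℝ} (hpos : ∀ x, 0 ≤ x → 0 < h x)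
    (hconv : ConvexOn ℝ (Ici 0) h) {N a b : ℝ} (hb : 0 ≤ b) (hba : b ≤ a) (haN : a ≤ N) :
    h a ≤ h b + h (N + 1) * (a - b) := by
  rcases hba.eq_or_lt with rfl | hlt
  · simp
  have h1 := hconv.slope_mono_adjacent (x := b) (y := a) (z := N + 1) (mem_Ici.2 hb)
    (mem_Ici.2 (by linarith)) hlt (by linarith)
  have hN := (hpos (N + 1) (by linarith)).le
  have h2 : (h (N + 1) - h a) / (N + 1 - a) ≤ h (N + 1) := by
    rw [div_le_iff₀ (by linarith)]
    nlinarith [hpos a (by linarith)]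
  have h3 := h1.trans h2
  rw [div_le_iff₀ (by linarith)] at h3
  linarith

/-- The function `h` truncated at level `N`, as a map on `[0,∞]`. -/
def truncatedGrowth (h : ℝ → ℝ) (N : ℝ) (a : ℝ≥0∞) : ℝ≥0∞ :=
  ENNReal.ofReal (h (min a (ENNReal.ofReal N)).toReal)

lemma truncatedGrowth_le_add {h : ℝ → ℝ} (hpos : ∀ x, 0 ≤ x → 0 < h x)
    (hmono : MonotoneOn h (Ici 0)) (hconv : ConvexOn ℝ (Ici 0) h) {N : ℝ} (hN : 0 ≤ N)
    {a b : ℝ≥0∞} {c : ℝ} (hc : 0 ≤ c) (hab : a ≤ b + ENNReal.ofReal c) :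
    truncatedGrowth h N a ≤ truncatedGrowth h N b + ENNReal.ofReal (h (N + 1) * c) := by
  set a' := (min a (ENNReal.ofReal N)).toReal with ha'
  set b' := (min b (ENNReal.ofReal N)).toReal with hb'
  have hfin : ∀ x, min x (ENNReal.ofReal N) ≠ ∞ := fun x =>
    ne_top_of_le_ne_top ENNReal.ofReal_ne_top (min_le_right _ _)
  have hN' := (hpos (N + 1) (by linarith)).le
  have ha0 : 0 ≤ a' := ENNReal.toReal_nonneg
  have hb0 : 0 ≤ b' := ENNReal.toReal_nonneg
  have haN : a' ≤ N := by
    have := ENNReal.toReal_mono ENNReal.ofReal_ne_top (min_le_right a (ENNReal.ofReal N))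
    rwa [ENNReal.toReal_ofReal hN] at this
  have hle : a' ≤ b' + c := by
    have h1 : min a (ENNReal.ofReal N) ≤ min b (ENNReal.ofReal N) + ENNReal.ofReal c := by
      rcases le_total b (ENNReal.ofReal N) with hbN | hbN
      · rw [min_eq_left hbN]; exact (min_le_left _ _).trans hab
      · rw [min_eq_right hbN]; exact (min_le_right _ _).trans le_self_add
    have h2 := ENNReal.toReal_mono (ENNReal.add_ne_top.2 ⟨hfin b, ENNReal.ofReal_ne_top⟩) h1
    rwa [ENNReal.toReal_add (hfin b) ENNReal.ofReal_ne_top, ENNReal.toReal_ofReal hc] at h2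
  rw [truncatedGrowth, truncatedGrowth, ← ENNReal.ofReal_add (hpos _ hb0).le (by positivity)]
  refine ENNReal.ofReal_le_ofReal ?_
  rcases le_total a' b' with hcase | hcase
  · have := hmono (mem_Ici.2 ha0) (mem_Ici.2 hb0) hcase
    have : 0 ≤ h (N + 1) * c := by positivity
    linarith
  · have := le_add_mul_sub_of_convexOn hpos hconv hb0 hcase haN
    have : h (N + 1) * (a' - b') ≤ h (N + 1) * c :=
      mul_le_mul_of_nonneg_left (by linarith) hN'
    linarith

/-- Jensen's inequality surviving truncation and an infinite mean `b`. The supporting line at `r =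
min b N` has slope `k ≥ 0`; integrating it gives `h(r) + k b ≤ ∫ h(g) + k r`, and the finite `k r ≤
k b` cancels. -/
lemma truncatedGrowth_lintegral_le {h : ℝ → ℝ} (hpos : ∀ x, 0 ≤ x → 0 < h x)
    (hdiff : DifferentiableOn ℝ h (Ici 0)) (hmono : MonotoneOn h (Ici 0))
    (hconv : ConvexOn ℝ (Ici 0) h) {N : ℝ} (hN : 0 < N) {X : Type*} [MeasurableSpace X]
    {μ : Measure X} [IsProbabilityMeasure μ] {g : X → ℝ} (hg : ∀ x, 1 ≤ g x) :
    truncatedGrowth h N (∫⁻ x, ENNReal.ofReal (g x) ∂μ) ≤ ∫⁻ x, ENNReal.ofReal (h (g x)) ∂μ := by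
  set b := ∫⁻ x, ENNReal.ofReal (g x) ∂μ with hb
  have hb1 : 1 ≤ b := by
    calc (1 : ℝ≥0∞) = ∫⁻ _, 1 ∂μ := by simp
      _ ≤ b := lintegral_mono fun x => by
        rw [← ENNReal.ofReal_one]; exact ENNReal.ofReal_le_ofReal (hg x)
  set r := (min b (ENNReal.ofReal N)).toReal with hr
  have hfin : min b (ENNReal.ofReal N) ≠ ∞ :=
    ne_top_of_le_ne_top ENNReal.ofReal_ne_top (min_le_right _ _)
  have hr0 : 0 < r := ENNReal.toReal_pos
    (ne_of_gt (lt_min (zero_lt_one.trans_le hb1) (ENNReal.ofReal_pos.2 hN))) hfin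
  obtain ⟨k, hk, hline⟩ := exists_supporting_slope hdiff hmono hconv hr0
  have hrb : ENNReal.ofReal r ≤ b := by
    rw [hr, ENNReal.ofReal_toReal hfin]; exact min_le_left _ _
  have hstep : ENNReal.ofReal (h r) + ENNReal.ofReal k * b ≤
      ∫⁻ x, ENNReal.ofReal (h (g x)) ∂μ + ENNReal.ofReal (k * r) := by
    calc ENNReal.ofReal (h r) + ENNReal.ofReal k * b
        = ∫⁻ x, (ENNReal.ofReal (h r) + ENNReal.ofReal k * ENNReal.ofReal (g x)) ∂μ := by
          rw [lintegral_add_left measurable_const, lintegral_const_mul' _ _ ENNReal.ofReal_ne_top]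
          simp [hb]
      _ ≤ ∫⁻ x, (ENNReal.ofReal (h (g x)) + ENNReal.ofReal (k * r)) ∂μ := by
          refine lintegral_mono fun x => ?_
          have hgx : 0 ≤ g x := zero_le_one.trans (hg x)
          rw [← ENNReal.ofReal_mul hk, ← ENNReal.ofReal_add (hpos r hr0.le).le (by positivity),
            ← ENNReal.ofReal_add (hpos _ hgx).le (by positivity)]
          exact ENNReal.ofReal_le_ofReal (hline _ hgx)
      _ = _ := by
          rw [lintegral_add_right _ measurable_const]
          simp
  have hkr : ENNReal.ofReal (k * r) ≤ ENNReal.ofReal k * b := by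
    rw [ENNReal.ofReal_mul hk]; gcongr
  exact (ENNReal.add_le_add_iff_right ENNReal.ofReal_ne_top).1
    ((add_le_add_right hkr _).trans hstep)

/-! ### The static weight and the supersolution -/

lemma one_le_rho0 {d : ℕ} (x : Space d) : 1 ≤ rho0 x := by
  rw [rho0, Real.one_le_sqrt, Real.le_log_iff_exp_le (by positivity)]
  nlinarith [sq_nonneg ‖x‖]

lemma continuous_rho0 {d : ℕ} : Continuous (rho0 (d := d)) := by
  unfold rho0
  exact Real.continuous_sqrt.comp
    (Continuous.log (by fun_prop) fun x => by positivity)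

lemma rho0_le_of_norm_le {d : ℕ} {x y : Space d} (h : ‖x‖ ≤ ‖y‖) : rho0 x ≤ rho0 y := by
  unfold rho0
  gcongr

/-- As `x` is the midpoint of `x + y` and `x - y`, one of the two has norm at least `‖x‖`. Averaging
over a symmetric law then gives the factor `2` in `IsHeatLaw.rho0_le`. -/
lemma rho0_le_add {d : ℕ} (x y : Space d) : rho0 x ≤ rho0 (x + y) + rho0 (x - y) := by
  have h1 := one_le_rho0 (x + y)
  have h2 := one_le_rho0 (x - y)
  rcases le_total ‖x‖ ‖x + y‖ with h | h
  · linarith [rho0_le_of_norm_le h]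
  · have h3 : ‖x‖ ≤ ‖x - y‖ := by
      have h4 := norm_add_le (x + y) (x - y)
      rw [show x + y + (x - y) = x + x by abel] at h4
      have h5 : ‖x + x‖ = 2 * ‖x‖ := by
        rw [← two_smul ℝ x, norm_smul]; norm_num
      linarith
    linarith [rho0_le_of_norm_le h3]

lemma IsHeatLaw.rho0_le {d : ℕ} {t : ℝ} {μ : Measure (Space d)} (hμ : IsHeatLaw t μ)
    (x : Space d) : ENNReal.ofReal (rho0 x) ≤ 2 * ∫⁻ y, ENNReal.ofReal (rho0 (x + y)) ∂μ := by
  have := hμ.isProbabilityMeasure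
  have hm : Measurable fun y : Space d => ENNReal.ofReal (rho0 (x + y)) :=
    (continuous_rho0.comp (by fun_prop : Continuous fun y => x + y)).measurable.ennreal_ofReal
  have hneg := hμ.lintegral_comp_neg hm
  calc ENNReal.ofReal (rho0 x) = ∫⁻ _, ENNReal.ofReal (rho0 x) ∂μ := by simp
    _ ≤ ∫⁻ y, (ENNReal.ofReal (rho0 (x + y)) + ENNReal.ofReal (rho0 (x + -y))) ∂μ := by
      refine lintegral_mono fun y => ?_
      rw [← ENNReal.ofReal_add (by linarith [one_le_rho0 (x + y)])
        (by linarith [one_le_rho0 (x + -y)]), ← sub_eq_add_neg]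
      exact ENNReal.ofReal_le_ofReal (rho0_le_add x y)
    _ = 2 * ∫⁻ y, ENNReal.ofReal (rho0 (x + y)) ∂μ := by
      rw [lintegral_add_left hm, hneg, two_mul]

/-- The heat semigroup applied to the Osgood flow started from `m ρ₀`. -/
def flowWeight {d : ℕ} (H E : ℝ → ℝ) (m : ℝ) (μ : Measure (Space d)) (t : ℝ) (x : Space d) :
    ℝ≥0∞ :=
  ∫⁻ y, ENNReal.ofReal (E (H (m * rho0 (x + y)) + t)) ∂μ

lemma IsOsgoodFlow.ofReal_flow_eq {h H E : ℝ → ℝ} (hE : IsOsgoodFlow h H E)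
    (hpos : ∀ x, 0 ≤ x → 0 < h x) (hcont : ContinuousOn h (Ici 0)) {a t : ℝ} (ha : 0 ≤ a)
    (ht : 0 ≤ t) :
    ENNReal.ofReal (E (H a + t)) = ENNReal.ofReal a +
      ∫⁻ s in Ioo 0 t, ENNReal.ofReal (h (max (E (H a + s)) 0)) := by
  have hEc := hE.continuous_inverse
  have hc : Continuous fun s => h (max (E (H a + s)) 0) :=
    hcont.comp_continuous (by fun_prop) fun s => mem_Ici.2 (le_max_right _ _)
  have hint : ∫ s in (0 : ℝ)..t, h (max (E (H a + s)) 0) = E (H a + t) - a := by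
    rw [intervalIntegral.integral_eq_sub_of_hasDerivAt (f := fun s => E (H a + s))
      (fun s _ => ?_) (hc.intervalIntegrable _ _), add_zero, hE.left_inv]
    exact ((hE.hasDerivAt_inverse (H a + s)).comp s ((hasDerivAt_id s).const_add (H a))).congr_deriv
      (mul_one _)
  have hnn : ∀ s, 0 ≤ h (max (E (H a + s)) 0) := fun s => (hpos _ (le_max_right _ _)).le
  rw [setLIntegral_congr Ioo_ae_eq_Ioc, ← ofReal_integral_eq_lintegral_ofReal
    hc.integrableOn_Ioc (Filter.Eventually.of_forall hnn), ← intervalIntegral.integral_of_le ht,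
    hint, ← ENNReal.ofReal_add ha (sub_nonneg.2 (hE.le_inverse_add a ht))]
  congr 1
  ring

lemma flowWeight_isSupersolution {d : ℕ} {h H E : ℝ → ℝ} (hE : IsOsgoodFlow h H E)
    (hpos : ∀ x, 0 ≤ x → 0 < h x) (hdiff : DifferentiableOn ℝ h (Ici 0))
    (hmono : MonotoneOn h (Ici 0)) (hconv : ConvexOn ℝ (Ici 0) h)
    {μ : ℝ → Measure (Space d)} (hμ : ∀ t, 0 ≤ t → IsHeatLaw t (μ t)) {m N : ℝ} (hm : 1 ≤ m)
    (hN : 0 < N) {t : ℝ} (ht : 0 ≤ t) (x : Space d) :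
    ENNReal.ofReal (m / 2 * rho0 x) + ∫⁻ s in Ioo 0 t, ∫⁻ y,
      ENNReal.ofReal (heatKernel (t - s) (x - y)) *
        truncatedGrowth h N (flowWeight H E m (μ s) s y) ≤ flowWeight H E m (μ t) t x := by
  have hcont := hdiff.continuousOn
  have hEc := hE.continuous_inverse
  have hHc := hE.continuous_primitive
  have hρc := continuous_rho0 (d := d)
  have hprob := (hμ t ht).isProbabilityMeasure
  obtain ⟨Ψ, hΨ⟩ : ∃ Ψ : ℝ → Space d → ℝ≥0∞, ∀ s y,
      Ψ s y = ENNReal.ofReal (h (max (E (H (m * rho0 y) + s)) 0)) := ⟨_, fun _ _ => rfl⟩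
  have hΨm : Measurable (Function.uncurry Ψ) := by
    have h1 : Function.uncurry Ψ = fun p : ℝ × Space d =>
        ENNReal.ofReal (h (max (E (H (m * rho0 p.2) + p.1)) 0)) := funext fun p => hΨ p.1 p.2
    rw [h1]
    refine Measurable.ennreal_ofReal (Continuous.measurable ?_)
    exact hcont.comp_continuous (by fun_prop) fun p => mem_Ici.2 (le_max_right _ _)
  have hρ1 : ∀ y : Space d, 1 ≤ m * rho0 y := fun y => by nlinarith [one_le_rho0 y]
  have hρm : Measurable fun y : Space d => ENNReal.ofReal (m * rho0 (x + y)) :=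
    Measurable.ennreal_ofReal (Continuous.measurable (by fun_prop))
  have hΨx : Measurable (Function.uncurry fun s y => Ψ s (x + y)) := by
    have h1 : Measurable fun p : ℝ × Space d => (p.1, x + p.2) := by fun_prop
    exact hΨm.comp h1
  have hw : flowWeight H E m (μ t) t x = ∫⁻ y, ENNReal.ofReal (m * rho0 (x + y)) ∂(μ t) +
      ∫⁻ s in Ioo 0 t, ∫⁻ y, Ψ s (x + y) ∂(μ t) := by
    have hswap := lintegral_lintegral_swap (μ := volume.restrict (Ioo 0 t)) (ν := μ t)
      (f := fun s y => Ψ s (x + y)) hΨx.aemeasurable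
    rw [hswap, ← lintegral_add_left hρm, flowWeight]
    refine lintegral_congr fun y => ?_
    simp only [hΨ]
    exact hE.ofReal_flow_eq hpos hcont (by linarith [hρ1 (x + y)]) ht
  rw [hw]
  refine add_le_add ?_ (setLIntegral_mono' measurableSet_Ioo fun s hs => ?_)
  · have h1 := (hμ t ht).rho0_le x
    have hm2 : 0 ≤ m / 2 := by linarith
    have h2 : ENNReal.ofReal (m / 2) * 2 = ENNReal.ofReal m := by
      rw [show (2 : ℝ≥0∞) = ENNReal.ofReal 2 by simp, ← ENNReal.ofReal_mul hm2,
        div_mul_cancel₀ _ two_ne_zero]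
    calc ENNReal.ofReal (m / 2 * rho0 x) = ENNReal.ofReal (m / 2) * ENNReal.ofReal (rho0 x) :=
          ENNReal.ofReal_mul hm2
      _ ≤ ENNReal.ofReal (m / 2) * (2 * ∫⁻ y, ENNReal.ofReal (rho0 (x + y)) ∂(μ t)) := by gcongr
      _ = ENNReal.ofReal m * ∫⁻ y, ENNReal.ofReal (rho0 (x + y)) ∂(μ t) := by
          rw [← mul_assoc, h2]
      _ = _ := by
          rw [← lintegral_const_mul' _ _ ENNReal.ofReal_ne_top]
          refine lintegral_congr fun y => ?_
          rw [ENNReal.ofReal_mul (by linarith)]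
  · have hs0 : 0 ≤ s := hs.1.le
    have hts : 0 < t - s := sub_pos.2 hs.2
    have := (hμ s hs0).isProbabilityMeasure
    have := (hμ _ hts.le).isProbabilityMeasure
    -- Semigroup property: the law at time `t` splits into a step of length `t - s`, which becomes
    -- the kernel, and one of length `s`, to which Jensen applies.
    have hsemi : μ t = μ (t - s) ∗ μ s := by
      have h1 := (hμ _ hts.le).conv (hμ s hs0)
      rw [sub_add_cancel] at h1
      exact (hμ t ht).unique h1
    have hΨs : Measurable (Ψ s) := hΨm.of_uncurry_left
    have hΨxs : Measurable fun y => Ψ s (x + y) := hΨs.comp (by fun_prop)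
    have hin : Measurable fun y => ∫⁻ y', Ψ s (y + y') ∂(μ s) := by
      have h1 : Measurable fun p : Space d × Space d => p.1 + p.2 := by fun_prop
      exact (hΨs.comp h1).lintegral_prod_right'
    rw [hsemi, Measure.lintegral_conv hΨxs]
    simp only [← add_assoc]
    rw [(hμ _ hts.le).lintegral_eq hts hin]
    refine lintegral_mono fun y => ?_
    dsimp only
    gcongr
    have hge : ∀ y', 1 ≤ E (H (m * rho0 (y + y')) + s) := fun y' =>
      (hρ1 _).trans (hE.le_inverse_add _ hs0)
    refine (truncatedGrowth_lintegral_le hpos hdiff hmono hconv hN hge).trans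
      (lintegral_mono fun y' => ?_)
    simp only [hΨ, max_eq_left (zero_le_one.trans (hge y'))]
    exact le_rfl

/-! ### Comparison principle -/

lemma lintegral_heatKernel {d : ℕ} {t : ℝ} (ht : 0 < t) (x : Space d) :
    ∫⁻ y, ENNReal.ofReal (heatKernel t (x - y)) = 1 := by
  have h := isHeatLaw_withDensity (d := d) ht
  have := h.isProbabilityMeasure
  have h1 := h.lintegral_eq ht (F := fun _ => 1) measurable_const x
  simpa using h1.symm

lemma setLIntegral_pow_div_factorial {C ℓ t : ℝ} (hC : 0 ≤ C) (hℓ : 0 ≤ ℓ) (ht : 0 ≤ t)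
    (n : ℕ) :
    ∫⁻ s in Ioo 0 t, ENNReal.ofReal (ℓ * (C * ((ℓ * s) ^ n / n.factorial))) =
      ENNReal.ofReal (C * ((ℓ * t) ^ (n + 1) / (n + 1).factorial)) := by
  have hc : Continuous fun s : ℝ => ℓ * (C * ((ℓ * s) ^ n / n.factorial)) := by fun_prop
  rw [setLIntegral_congr Ioo_ae_eq_Ioc, ← ofReal_integral_eq_lintegral_ofReal
    hc.integrableOn_Ioc, ← intervalIntegral.integral_of_le ht]
  · congr 1
    have : ∀ s : ℝ, ℓ * (C * ((ℓ * s) ^ n / n.factorial)) =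
        (ℓ ^ (n + 1) * C / n.factorial) * s ^ n := fun s => by
      rw [mul_pow]; ring
    simp_rw [this]
    rw [intervalIntegral.integral_const_mul, integral_pow, Nat.factorial_succ]
    push_cast
    have := n.factorial_ne_zero
    field_simp
    ring
  · rw [Filter.EventuallyLE, ae_restrict_iff' measurableSet_Ioc]
    refine Filter.Eventually.of_forall fun s hs => ?_
    have := hs.1.le
    positivity

/-- Comparison principle for the mild heat equation with source `truncatedGrowth h N`. -/
lemma comparison {d : ℕ} {h : ℝ → ℝ} (hpos : ∀ x, 0 ≤ x → 0 < h x)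
    (hmono : MonotoneOn h (Ici 0)) (hconv : ConvexOn ℝ (Ici 0) h) {T N C : ℝ} (hN : 0 < N)
    (hC : 0 ≤ C) {a w ζ : ℝ → Space d → ℝ≥0∞}
    (haC : ∀ t ∈ Icc 0 T, ∀ x, a t x ≤ ENNReal.ofReal C)
    (ha : ∀ t ∈ Icc 0 T, ∀ x, a t x ≤ ζ t x + ∫⁻ s in Ioo 0 t, ∫⁻ y,
      ENNReal.ofReal (heatKernel (t - s) (x - y)) * truncatedGrowth h N (a s y))
    (hw : ∀ t ∈ Icc 0 T, ∀ x, ζ t x + ∫⁻ s in Ioo 0 t, ∫⁻ y,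
      ENNReal.ofReal (heatKernel (t - s) (x - y)) * truncatedGrowth h N (w s y) ≤ w t x) :
    ∀ t ∈ Icc 0 T, ∀ x, a t x ≤ w t x := by
  set ℓ := h (N + 1) with hℓ
  have hℓ0 : 0 ≤ ℓ := (hpos _ (by linarith)).le
  -- Starting from the a priori bound `C`, each use of the equation multiplies the error by the
  -- Lipschitz constant `ℓ` and integrates it in time; the kernel has mass one. The errors `C (ℓ t)ⁿ
  -- / n!` tend to `0`.
  have key : ∀ n : ℕ, ∀ t ∈ Icc 0 T, ∀ x,
      a t x ≤ w t x + ENNReal.ofReal (C * ((ℓ * t) ^ n / n.factorial)) := by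
    intro n
    induction n with
    | zero =>
      intro t ht x
      simpa using (haC t ht x).trans le_add_self
    | succ n ih =>
      intro t ht x
      have hinner : ∀ s ∈ Ioo 0 t, ∫⁻ y,
          ENNReal.ofReal (heatKernel (t - s) (x - y)) * truncatedGrowth h N (a s y) ≤
          (∫⁻ y, ENNReal.ofReal (heatKernel (t - s) (x - y)) * truncatedGrowth h N (w s y)) +
            ENNReal.ofReal (ℓ * (C * ((ℓ * s) ^ n / n.factorial))) := by
        intro s hs
        have hs0 := hs.1.le
        have hsT : s ∈ Icc 0 T := ⟨hs0, hs.2.le.trans ht.2⟩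
        have hGm : Measurable fun y => ENNReal.ofReal (heatKernel (t - s) (x - y)) :=
          ((continuous_heatKernel (t - s)).comp
            (by fun_prop : Continuous fun y => x - y)).measurable.ennreal_ofReal
        set c := C * ((ℓ * s) ^ n / n.factorial) with hc
        have hc0 : 0 ≤ c := by positivity
        calc _ ≤ ∫⁻ y, (ENNReal.ofReal (heatKernel (t - s) (x - y)) *
                truncatedGrowth h N (w s y) +
              ENNReal.ofReal (heatKernel (t - s) (x - y)) * ENNReal.ofReal (ℓ * c)) := by
              refine lintegral_mono fun y => ?_
              dsimp only
              rw [← mul_add]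
              gcongr
              exact truncatedGrowth_le_add hpos hmono hconv hN.le hc0 (ih s hsT y)
          _ = _ := by
              rw [lintegral_add_right _ (hGm.mul_const _), lintegral_mul_const _ hGm,
                lintegral_heatKernel (sub_pos.2 hs.2), one_mul]
      calc a t x ≤ _ := ha t ht x
        _ ≤ ζ t x + ∫⁻ s in Ioo 0 t, ((∫⁻ y, ENNReal.ofReal (heatKernel (t - s) (x - y)) *
              truncatedGrowth h N (w s y)) +
            ENNReal.ofReal (ℓ * (C * ((ℓ * s) ^ n / n.factorial)))) := by
            exact add_le_add le_rfl (setLIntegral_mono' measurableSet_Ioo hinner)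
        _ = (ζ t x + ∫⁻ s in Ioo 0 t, ∫⁻ y, ENNReal.ofReal (heatKernel (t - s) (x - y)) *
              truncatedGrowth h N (w s y)) +
            ENNReal.ofReal (C * ((ℓ * t) ^ (n + 1) / (n + 1).factorial)) := by
            rw [lintegral_add_right _ (by fun_prop),
              setLIntegral_pow_div_factorial hC hℓ0 ht.1, add_assoc]
        _ ≤ _ := by gcongr; exact hw t ht x
  intro t ht x
  have hlim : Filter.Tendsto (fun n : ℕ => w t x +
      ENNReal.ofReal (C * ((ℓ * t) ^ n / n.factorial))) Filter.atTop (nhds (w t x + 0)) := by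
    refine tendsto_const_nhds.add ?_
    have := (FloorSemiring.tendsto_pow_div_factorial_atTop (ℓ * t)).const_mul C
    rw [mul_zero] at this
    simpa using ENNReal.tendsto_ofReal this
  rw [add_zero] at hlim
  exact ge_of_tendsto' hlim fun n => key n t ht x

/-! ### Growth of the double exponential -/

/-- With `L = log (e + ‖y‖²)` the inner exponent is `L ^ β`, where `β = α ν / 2 < 1`. Hence it is at
most a constant plus `L / 2`, and `exp (L / 2) = √(e + ‖y‖²)` is at most `2 + ‖y‖`. -/
lemma exists_exp_exp_rho0_le {d : ℕ} {α ν : ℝ} (hαν0 : 0 ≤ α * ν) (hαν : α * ν < 2) :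
    ∃ A, 0 < A ∧ ∀ y : Space d,
      Real.exp (Real.exp ((rho0 y ^ α) ^ ν)) ≤ Real.exp (A * (2 + ‖y‖)) := by
  set β := α * ν / 2 with hβ
  have hβ1 : β < 1 := by linarith
  have hβ0 : 0 ≤ β := by positivity
  -- Threshold beyond which `L ^ (1 - β) ≥ 2`, that is, `L ^ β ≤ L / 2`.
  set L₀ : ℝ := 2 ^ (1 / (1 - β)) with hL₀
  have hL₀0 : 0 < L₀ := by positivity
  refine ⟨Real.exp (L₀ ^ β), Real.exp_pos _, fun y => Real.exp_le_exp.2 ?_⟩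
  set L := Real.log (Real.exp 1 + ‖y‖ ^ 2) with hL
  have hL1 : 1 ≤ L := by
    rw [hL, Real.le_log_iff_exp_le (by positivity)]
    nlinarith [sq_nonneg ‖y‖]
  have hpow : (rho0 y ^ α) ^ ν = L ^ β := by
    rw [rho0, ← hL, Real.sqrt_eq_rpow, ← Real.rpow_mul (by positivity),
      ← Real.rpow_mul (by linarith)]
    congr 1
    rw [hβ]; ring
  have hLβ : L ^ β ≤ L₀ ^ β + L / 2 := by
    rcases le_total L L₀ with hle | hle
    · have := Real.rpow_le_rpow (by linarith) hle hβ0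
      linarith
    · have h1 : (2 : ℝ) ≤ L ^ (1 - β) := by
        have := Real.rpow_le_rpow hL₀0.le hle (sub_nonneg.2 hβ1.le)
        rwa [hL₀, one_div, Real.rpow_inv_rpow (by norm_num) (by linarith)] at this
      have h2 : L ^ (1 - β) * L ^ β = L := by
        rw [← Real.rpow_add (by linarith), sub_add_cancel, Real.rpow_one]
      have h3 : 0 ≤ L ^ β := Real.rpow_nonneg (by linarith) _
      have h4 : 0 ≤ L₀ ^ β := Real.rpow_nonneg hL₀0.le _
      nlinarith
  have hhalf : Real.exp (L / 2) ≤ 2 + ‖y‖ := by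
    refine (pow_le_pow_iff_left₀ (by positivity) (by positivity) two_ne_zero).1 ?_
    rw [← Real.exp_nat_mul, Nat.cast_ofNat, mul_div_cancel₀ _ two_ne_zero, hL,
      Real.exp_log (by positivity)]
    nlinarith [Real.exp_one_lt_d9, norm_nonneg y]
  rw [hpow]
  calc Real.exp (L ^ β) ≤ Real.exp (L₀ ^ β + L / 2) := Real.exp_le_exp.2 hLβ
    _ = Real.exp (L₀ ^ β) * Real.exp (L / 2) := Real.exp_add _ _
    _ ≤ _ := by gcongr

/-! ### Truncated solutions and the dynamic weight -/

lemma abs_cutoff {N : ℝ} (hN : 0 < N) (r : ℝ) : |cutoff N r| = min |r| N := by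
  unfold cutoff
  rcases le_total 0 r with hr | hr
  · rw [abs_of_nonneg hr, max_eq_right (by linarith [le_min hr hN.le]),
      abs_of_nonneg (le_min hr hN.le)]
  · rw [min_eq_left (by linarith), abs_of_nonpos (max_le (by linarith) hr), abs_of_nonpos hr]
    rcases le_total (-N) r with h | h
    · rw [max_eq_right h, min_eq_left (by linarith)]
    · rw [max_eq_left h, min_eq_right (by linarith), neg_neg]

lemma truncatedGrowth_ofReal {h : ℝ → ℝ} {N r : ℝ} (hN : 0 < N) (hr : 0 ≤ r) :
    truncatedGrowth h N (ENNReal.ofReal r) = ENNReal.ofReal (h (min r N)) := by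
  rw [truncatedGrowth, ← ENNReal.ofReal_min, ENNReal.toReal_ofReal (le_min hr hN.le)]

lemma IsTruncatedSolution.ofReal_abs_le {d : ℕ} {f h : ℝ → ℝ} {z u : ℝ → Space d → ℝ}
    {T N : ℝ} (hdom : ∀ x, |f x| ≤ h |x|) (hN : 0 < N) (hu : IsTruncatedSolution f z T N u)
    {t : ℝ} (ht : t ∈ Icc 0 T) (x : Space d) :
    ENNReal.ofReal |u t x| ≤ ENNReal.ofReal |z t x| + ∫⁻ s in Ioo 0 t, ∫⁻ y,
      ENNReal.ofReal (heatKernel (t - s) (x - y)) *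
        truncatedGrowth h N (ENNReal.ofReal |u s y|) := by
  rw [hu.equation t ht x, add_comm]
  refine (ENNReal.ofReal_le_ofReal (abs_add_le _ _)).trans ?_
  rw [ENNReal.ofReal_add (abs_nonneg _) (abs_nonneg _)]
  refine add_le_add (ENNReal.ofReal_le_ofReal ?_) ?_
  · rw [abs_cutoff hN]; exact min_le_left _ _
  -- The endpoint `s = t` is discarded so that the kernel has positive time. Bounding norms of
  -- integrals by lower integrals of norms needs no integrability.
  rw [← Real.enorm_eq_ofReal_abs, intervalIntegral.integral_of_le ht.1,
    setLIntegral_congr Ioo_ae_eq_Ioc, ← setIntegral_congr_set Ioo_ae_eq_Ioc,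
    ← setLIntegral_congr Ioo_ae_eq_Ioc]
  refine (enorm_integral_le_lintegral_enorm _).trans
    (setLIntegral_mono' measurableSet_Ioo fun s hs => ?_)
  refine (enorm_integral_le_lintegral_enorm _).trans (lintegral_mono fun y => ?_)
  dsimp only
  rw [enorm_mul, Real.enorm_eq_ofReal (heatKernel_nonneg (sub_pos.2 hs.2).le _),
    truncatedGrowth_ofReal hN (abs_nonneg _), ← abs_cutoff hN, Real.enorm_eq_ofReal_abs]
  gcongr
  exact hdom _


lemma dynamicWeight_lt_top {d : ℕ} {f h ν : ℝ → ℝ} (hf : DriftAssumption f h ν)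
    {T : ℝ} (hT : 0 < T) {α : ℝ} (hα : α ∈ Ioo 1 (2 / ν (2 * T))) {Ω : Type*}
    [MeasurableSpace Ω] {P : Measure Ω} [IsProbabilityMeasure P] {B : ℝ≥0 → Ω → Space d}
    (hB : IsStandardWiener B P) (hα2 : α ≤ 2) {t : ℝ} (ht : t ∈ Icc 0 T) (x : Space d) :
    dynamicWeight h α B P t x < ∞ := by
  have hcont := hf.differentiable.continuousOn
  obtain ⟨H, E, hE⟩ := exists_isOsgoodFlow hf.pos hcont hf.osgood
  have hα0 : 0 < α := by linarith [hα.1]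
  have hν := (hf.exponent_mem (2 * T) (by linarith)).1
  have hαν : α * ν (2 * T) < 2 := (lt_div_iff₀ hν).1 hα.2
  obtain ⟨C, hC, hgrowth⟩ := hf.growth (2 * T) (by linarith)
  obtain ⟨A, hA, hexp⟩ := exists_exp_exp_rho0_le (d := d) (by positivity) hαν
  have hbound : ∀ b : Space d, osgoodInverse (hAlpha h α)
      (osgoodPrimitive (hAlpha h α) (rho0 (x + b)) + t) ≤
      C * Real.exp (A * (2 + ‖x‖)) * Real.exp (A * ‖b‖) := by
    intro b
    have hρ := one_le_rho0 (x + b)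
    have hρα : 1 ≤ rho0 (x + b) ^ α := Real.one_le_rpow hρ hα0.le
    rw [hE.flow_hAlpha hf.pos hcont hα.1 (by linarith) ht.1]
    set Q := E (H (rho0 (x + b) ^ α) + α * t) with hQ
    have hQ1 : 1 ≤ Q := hρα.trans (hE.le_inverse_add _ (mul_nonneg hα0.le ht.1))
    have hQroot : Q ^ (1 / α) ≤ Q := by
      conv_rhs => rw [← Real.rpow_one Q]
      exact Real.rpow_le_rpow_of_exponent_le hQ1 ((div_le_one hα0).2 hα.1.le)
    -- Here `α ≤ 2` enters: `α * t ≤ 2 * T`, the time at which the growth condition is invoked.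
    have hQT : Q ≤ E (H (rho0 (x + b) ^ α) + 2 * T) := by
      refine hE.monotone_inverse.monotone (add_le_add le_rfl ?_)
      nlinarith [ht.1, ht.2]
    have hg := hgrowth (rho0 (x + b) ^ α) (by linarith)
    have hHnn := hE.primitive_nonneg (x := rho0 (x + b) ^ α) (by linarith)
    rw [hE.primitive_eq _ (by linarith), hE.inverse_eq _ (by linarith)] at hg
    refine hQroot.trans (hQT.trans (hg.trans ?_))
    rw [mul_assoc, ← Real.exp_add]
    refine mul_le_mul_of_nonneg_left ((hexp (x + b)).trans (Real.exp_le_exp.2 ?_)) hC.le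
    nlinarith [norm_add_le x b]
  have hexpm : Measurable fun b : Space d => ENNReal.ofReal (Real.exp (A * ‖b‖)) := by fun_prop
  have hlaw := (hB.isHeatLaw ht.1).lintegral_exp_norm_lt_top ht.1 A
  rw [lintegral_map' hexpm.aemeasurable (hB.aemeasurable _)] at hlaw
  calc dynamicWeight h α B P t x
      ≤ ∫⁻ ω, ENNReal.ofReal (C * Real.exp (A * (2 + ‖x‖))) *
          ENNReal.ofReal (Real.exp (A * ‖B t.toNNReal ω‖)) ∂P := by
        refine lintegral_mono fun ω => ?_
        dsimp only
        rw [← ENNReal.ofReal_mul (by positivity)]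
        exact ENNReal.ofReal_le_ofReal (hbound _)
    _ = ENNReal.ofReal (C * Real.exp (A * (2 + ‖x‖))) *
          ∫⁻ ω, ENNReal.ofReal (Real.exp (A * ‖B t.toNNReal ω‖)) ∂P :=
        lintegral_const_mul' _ _ ENNReal.ofReal_ne_top
    _ < ∞ := ENNReal.mul_lt_top ENNReal.ofReal_lt_top hlaw

lemma exists_flowWeight_le {d : ℕ} {f h ν : ℝ → ℝ} (hf : DriftAssumption f h ν)
    {H E : ℝ → ℝ} (hE : IsOsgoodFlow h H E) (T : ℝ) {α : ℝ} (hα : 1 < α) {Ω : Type*}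
    [MeasurableSpace Ω] {P : Measure Ω} [IsProbabilityMeasure P] {B : ℝ≥0 → Ω → Space d}
    (hB : IsStandardWiener B P) {m : ℝ} (hm : 0 < m) :
    ∃ K, 0 < K ∧ ∀ t ∈ Icc 0 T, ∀ x,
      flowWeight H E m (P.map (B t.toNNReal)) t x ≤
        ENNReal.ofReal K * dynamicWeight h α B P t x := by
  have hcont := hf.differentiable.continuousOn
  have hEc := hE.continuous_inverse
  have hHc := hE.continuous_primitive
  have hρc := continuous_rho0 (d := d)
  obtain ⟨K, hK, hle⟩ := exists_flow_le hE hf.pos hf.strictly_convex.convexOn hα hm T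
  refine ⟨K, hK, fun t ht x => ?_⟩
  have hmeas : Measurable fun y : Space d => ENNReal.ofReal (E (H (m * rho0 (x + y)) + t)) :=
    Measurable.ennreal_ofReal (Continuous.measurable (by fun_prop))
  rw [flowWeight, lintegral_map' hmeas.aemeasurable (hB.aemeasurable _), dynamicWeight,
    ← lintegral_const_mul' _ _ ENNReal.ofReal_ne_top]
  refine lintegral_mono fun ω => ?_
  dsimp only
  have hρ := one_le_rho0 (x + B t.toNNReal ω)
  rw [← ENNReal.ofReal_mul hK.le, hE.flow_hAlpha hf.pos hcont hα (by linarith) ht.1]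
  exact ENNReal.ofReal_le_ofReal (hle _ hρ t ht)

end OsgoodHeat

end

theorem mainTheorem5 {d : ℕ} {f h ν : ℝ → ℝ} (hf : OsgoodHeat.DriftAssumption f h ν)
    {T : ℝ} (hT : 0 < T) {α : ℝ} (hα : α ∈ Set.Ioo 1 (2 / ν (2 * T)))
    {Ω : Type*} [MeasurableSpace Ω] {P : MeasureTheory.Measure Ω}
    [MeasureTheory.IsProbabilityMeasure P]
    {B : ℝ≥0 → Ω → OsgoodHeat.Space d} (hB : OsgoodHeat.IsStandardWiener B P) :
    (α ≤ 2 → ∀ t ∈ Set.Icc 0 T, ∀ x, OsgoodHeat.dynamicWeight h α B P t x < ∞) ∧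
    ∀ M : ℝ, ∃ K : ℝ, 0 < K ∧
      ∀ z : ℝ → OsgoodHeat.Space d → ℝ,
        ContinuousOn (fun p : ℝ × OsgoodHeat.Space d => z p.1 p.2) (Set.Icc 0 T ×ˢ Set.univ) →
        IsLUB {r : ℝ | ∃ t ∈ Set.Icc 0 T, ∃ x, r = |z t x| / OsgoodHeat.rho0 x} M →
        ∀ N : ℝ, 0 < N → ∀ u : ℝ → OsgoodHeat.Space d → ℝ,
          OsgoodHeat.IsTruncatedSolution f z T N u →
          (⨆ t ∈ Set.Icc 0 T, ⨆ x,
            ENNReal.ofReal |u t x| / OsgoodHeat.dynamicWeight h α B P t x) ≤ ENNReal.ofReal K := by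
  refine ⟨fun hα2 t ht x => OsgoodHeat.dynamicWeight_lt_top hf hT hα hB hα2 ht x, fun M => ?_⟩
  obtain ⟨H, E, hE⟩ := OsgoodHeat.exists_isOsgoodFlow hf.pos hf.differentiable.continuousOn
    hf.osgood
  -- The `2` compensates for `ρ₀ ≤ 2 P_t ρ₀`; the maximum with `1` keeps `m ρ₀ ≥ 1`, as the Jensen
  -- step requires.
  have hm : 1 ≤ 2 * max M 1 := by linarith [le_max_right M 1]
  obtain ⟨K, hK, hweight⟩ := OsgoodHeat.exists_flowWeight_le hf hE T hα.1 hB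
    (zero_lt_one.trans_le hm)
  refine ⟨K, hK, fun z _ hM N hN u hu => iSup₂_le fun t ht => iSup_le fun x => ?_⟩
  refine ENNReal.div_le_of_le_mul (le_trans ?_ (hweight t ht x))
  obtain ⟨C, hC⟩ := hu.bounded
  have hz : ∀ t ∈ Set.Icc 0 T, ∀ x, |z t x| ≤ 2 * max M 1 / 2 * OsgoodHeat.rho0 x := by
    intro t ht x
    have hρ := OsgoodHeat.one_le_rho0 x
    have h1 := (div_le_iff₀ (by linarith)).1 (hM.1 ⟨t, ht, x, rfl⟩)
    rw [mul_div_cancel_left₀ _ two_ne_zero]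
    exact h1.trans (mul_le_mul_of_nonneg_right (le_max_left _ _) (by linarith))
  refine OsgoodHeat.comparison (T := T) (C := |C|) (a := fun t x => ENNReal.ofReal |u t x|)
    (w := fun t x => OsgoodHeat.flowWeight H E (2 * max M 1) (P.map (B t.toNNReal)) t x)
    (ζ := fun _ x => ENNReal.ofReal (2 * max M 1 / 2 * OsgoodHeat.rho0 x))
    hf.pos hf.increasing hf.strictly_convex.convexOn hN (abs_nonneg C)
    (fun t ht x => ENNReal.ofReal_le_ofReal ((hC t ht x).trans (le_abs_self C)))
    (fun t ht x => ?_) (fun t ht x => ?_) t ht x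
  · exact (hu.ofReal_abs_le hf.dominates hN ht x).trans
      (add_le_add (ENNReal.ofReal_le_ofReal (hz t ht x)) le_rfl)
  · exact OsgoodHeat.flowWeight_isSupersolution (μ := fun t => P.map (B t.toNNReal)) hE hf.pos
      hf.differentiable hf.increasing hf.strictly_convex.convexOn
      (fun t ht => hB.isHeatLaw ht) hm hN ht.1 x
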